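/- Let $E^3$ be the $3$-dimensional Euclidean space and let $\mathcal K^3$ be the family of convex bodies in $E^3$, i.e., of bounded convex sets with non-empty interior. For a bounded set $C\subset E^3$ and a direction $m$, the width of $C$ in direction $m$ is the width of the smallest strip (the region between two parallel planes) perpendicular to $m$ that contains $C$; the minimal width $w(C)$ is the minimum of these widths over all directions. For $C\in\mathcal K^3$ put $$\lambda_n(C)=\sup\Big\{\frac{w(P)}{w(C)} : P\subset C \text{ is a convex polytope with at most } n \text{ vertices}\Big\},\qquad \Lambda_n(\mathcal K^3)=\inf\{\lambda_n(C) : C\in\mathcal K^3\}.$$ Then $\Lambda_6(\mathcal K^3)\ge \frac1{\sqrt3}\ (\approx 0.577)$, $\Lambda_8(\mathcal K^3)\ge 0.654$, $\Lambda_{10}(\mathcal K^3)\ge 0.695$, $\Lambda_{12}(\mathcal K^3)\ge \frac1{\sqrt3}\cot\frac{\pi}{5}\ (\approx 0.794)$, $\Lambda_{14}(\mathcal K^3)\ge 0.806$ and $\Lambda_{16}(\mathcal K^3)\ge 0.833$, where the approximate values are truncated after three decimals. -/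

import Mathlib

namespace InscribedPolytope

/-- The family `𝒦ᵈ` of convex bodies of `Eᵈ`: bounded convex sets with non-empty interior. -/
def convexBodies (d : ℕ) : Set (Set (EuclideanSpace ℝ (Fin d))) :=
  {C | Convex ℝ C ∧ Bornology.IsBounded C ∧ (interior C).Nonempty}

/-- The region between the hyperplanes `⟪m, x⟫ = a` and `⟪m, x⟫ = b`. For a unit vector `m` and
`a < b` this is a strip of direction `m` and of width `b - a`. -/
def strip {d : ℕ} (m : EuclideanSpace ℝ (Fin d)) (a b : ℝ) : Set (EuclideanSpace ℝ (Fin d)) :=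
  {x | a ≤ inner ℝ m x ∧ inner ℝ m x ≤ b}

/-- The width of `C` in the direction of the unit vector `m`: the infimum of the widths of the
strips of direction `m` that contain `C`. It is `0` if `C` is non-empty and lies in a hyperplane
perpendicular to `m`. -/
noncomputable def widthIn {d : ℕ} (m : EuclideanSpace ℝ (Fin d))
    (C : Set (EuclideanSpace ℝ (Fin d))) : ℝ :=
  sInf {t : ℝ | ∃ a b : ℝ, a < b ∧ C ⊆ strip m a b ∧ t = b - a}

/-- The minimal width `w(C)`. -/
noncomputable def minWidth {d : ℕ} (C : Set (EuclideanSpace ℝ (Fin d))) : ℝ :=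
  sInf {t : ℝ | ∃ m : EuclideanSpace ℝ (Fin d), ‖m‖ = 1 ∧ t = widthIn m C}

/-- A (convex) polytope: the convex hull of finitely many points, at least one. -/
def IsPolytope {d : ℕ} (P : Set (EuclideanSpace ℝ (Fin d))) : Prop :=
  ∃ V : Finset (EuclideanSpace ℝ (Fin d)),
    V.Nonempty ∧ P = convexHull ℝ (V : Set (EuclideanSpace ℝ (Fin d)))

/-- `λ_n(C)`: the supremum of `w(P) / w(C)` over the polytopes `P ⊆ C` with at most `n`
vertices (extreme points). -/
noncomputable def lambda {d : ℕ} (n : ℕ) (C : Set (EuclideanSpace ℝ (Fin d))) : ℝ :=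
  sSup {r : ℝ | ∃ P : Set (EuclideanSpace ℝ (Fin d)), IsPolytope P ∧ P ⊆ C ∧
    (P.extremePoints ℝ).encard ≤ (n : ℕ∞) ∧ r = minWidth P / minWidth C}

/-- `Λ_n(ℬ)`: the infimum of `λ_n(C)` over the members `C` of the family `ℬ`. -/
noncomputable def Lambda {d : ℕ} (n : ℕ) (B : Set (Set (EuclideanSpace ℝ (Fin d)))) : ℝ :=
  sInf {r : ℝ | ∃ C ∈ B, r = lambda n C}

end InscribedPolytope

namespace InscribedPolytope

variable {d : ℕ}

local notation "E" d => EuclideanSpace ℝ (Fin d)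

/-! A convex body `C` contains, in every direction, chords of any length `s < w(C)`
(`exists_chord`): otherwise the interior of `C` and its translate by `s • u` could be separated,
which would squeeze `C` into a strip of width at most `s`. Take such chords along `k` vectors `v i`
of the unit ball. Their convex hull has at most `2k` vertices, and its width in direction `m` is at
least `s * |⟪m, v i⟫|` for each `i`. Hence `Λ_{2k} ≥ c` as soon as every unit `m` satisfies `|⟪m, v
i⟫| ≥ c` for some `i` (`le_Lambda_of_directions`). The convex body has disappeared; what remains is
to cover the sphere by `k` antipodal pairs of caps.

The covering holds if the symmetric polytope `|⟪p, v i⟫| ≤ c` lies in the unit ball. A point of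
largest norm in it is a vertex, so for rational directions this is a finite check on integer
vertices given by Cramer's rule. It settles 3, 4, 5, 7 and 8 directions. For 6 directions the
vectors are the diagonals of an icosahedron; the polytope is a regular dodecahedron, treated by hand
over `φ`. -/

/-! ### Basic properties of widths. -/

theorem widthIn_nonneg (m : E d) (C : Set (E d)) : 0 ≤ widthIn m C := by
  apply Real.sInf_nonneg
  rintro t ⟨a, b, hab, -, rfl⟩
  linarith

theorem widthIn_le {m : E d} {C : Set (E d)} {a b : ℝ} (hab : a < b) (h : C ⊆ strip m a b) :
    widthIn m C ≤ b - a := by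
  refine csInf_le ⟨0, ?_⟩ ⟨a, b, hab, h, rfl⟩
  rintro t ⟨a, b, hab, -, rfl⟩
  linarith

theorem exists_subset_strip {C : Set (E d)} (hC : Bornology.IsBounded C) (m : E d) :
    ∃ a b : ℝ, a < b ∧ C ⊆ strip m a b := by
  obtain ⟨R, hR⟩ := hC.exists_norm_le
  refine ⟨-(‖m‖ * |R| + 1), ‖m‖ * |R| + 1, by nlinarith [norm_nonneg m, abs_nonneg R], ?_⟩
  intro x hx
  have h1 : |inner ℝ m x| ≤ ‖m‖ * |R| := (abs_real_inner_le_norm m x).trans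
    (mul_le_mul_of_nonneg_left ((hR x hx).trans (le_abs_self R)) (norm_nonneg m))
  have h2 := abs_le.1 h1
  exact ⟨by linarith, by linarith⟩

theorem abs_inner_sub_le_widthIn {C : Set (E d)} (hC : Bornology.IsBounded C) (m : E d)
    {x y : E d} (hx : x ∈ C) (hy : y ∈ C) : |inner ℝ m (y - x)| ≤ widthIn m C := by
  obtain ⟨a, b, hab, h⟩ := exists_subset_strip hC m
  refine le_csInf ⟨_, a, b, hab, h, rfl⟩ ?_
  rintro t ⟨a, b, -, h, rfl⟩
  obtain ⟨h1, h2⟩ := h hx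
  obtain ⟨h3, h4⟩ := h hy
  rw [inner_sub_right, abs_le]
  constructor <;> linarith

theorem widthIn_mono {P C : Set (E d)} (hC : Bornology.IsBounded C) (hPC : P ⊆ C) (m : E d) :
    widthIn m P ≤ widthIn m C := by
  obtain ⟨a, b, hab, h⟩ := exists_subset_strip hC m
  refine le_csInf ⟨_, a, b, hab, h, rfl⟩ ?_
  rintro t ⟨a, b, hab, h, rfl⟩
  exact widthIn_le hab (hPC.trans h)

theorem minWidth_le_widthIn {m : E d} (hm : ‖m‖ = 1) (C : Set (E d)) :
    minWidth C ≤ widthIn m C := by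
  refine csInf_le ⟨0, ?_⟩ ⟨m, hm, rfl⟩
  rintro t ⟨m, -, rfl⟩
  exact widthIn_nonneg m C

theorem minWidth_nonneg (C : Set (E d)) : 0 ≤ minWidth C := by
  apply Real.sInf_nonneg
  rintro t ⟨m, -, rfl⟩
  exact widthIn_nonneg m C

/-- In dimension 0 there is no unit vector and `minWidth` takes the default value `0`, so `d ≠ 0` is
needed. -/
theorem le_minWidth [NeZero d] {C : Set (E d)} {r : ℝ}
    (h : ∀ m : E d, ‖m‖ = 1 → r ≤ widthIn m C) : r ≤ minWidth C := by
  refine le_csInf ⟨_, EuclideanSpace.single 0 1, by simp, rfl⟩ ?_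
  rintro t ⟨m, hm, rfl⟩
  exact h m hm

theorem minWidth_mono [NeZero d] {P C : Set (E d)} (hC : Bornology.IsBounded C) (hPC : P ⊆ C) :
    minWidth P ≤ minWidth C :=
  le_minWidth fun m hm => (minWidth_le_widthIn hm P).trans (widthIn_mono hC hPC m)

theorem minWidth_pos [NeZero d] {C : Set (E d)} (hC : C ∈ convexBodies d) : 0 < minWidth C := by
  obtain ⟨-, hb, x, hx⟩ := hC
  obtain ⟨r, hr, hball⟩ := Metric.mem_nhds_iff.1 (mem_interior_iff_mem_nhds.1 hx)
  refine (half_pos hr).trans_le (le_minWidth fun m hm => ?_)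
  have hy : x + (r / 2) • m ∈ C := by
    apply hball
    rw [mem_ball_iff_norm, add_sub_cancel_left, norm_smul, hm, Real.norm_eq_abs,
      abs_of_pos (half_pos hr)]
    linarith
  have h := abs_inner_sub_le_widthIn hb m (interior_subset hx) hy
  rwa [add_sub_cancel_left, real_inner_smul_right, real_inner_self_eq_norm_sq, hm, one_pow,
    mul_one, abs_of_pos (half_pos hr)] at h

/-! ### From chords to polytopes. -/

/-- A convex body contains, in every direction, a segment of any length below its minimal
width. -/
theorem exists_chord {C : Set (E d)} (hC : C ∈ convexBodies d) {u : E d} (hu : ‖u‖ ≤ 1) {s : ℝ}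
    (hs0 : 0 ≤ s) (hs : s < minWidth C) : ∃ x ∈ C, x + s • u ∈ C := by
  obtain ⟨hconv, -, hne⟩ := hC
  by_contra! hcon
  have hdisj : Disjoint (interior C) ((fun y => s • u + y) '' interior C) := by
    rw [Set.disjoint_left]
    rintro _ hx ⟨y, hy, rfl⟩
    exact hcon y (interior_subset hy) (by rw [add_comm]; exact interior_subset hx)
  -- A hyperplane `f = c` separating the two interiors bounds `f` on `C` from above by `c` and,
  -- shifted back by `s • u`, from below by `c - s * f u`.
  obtain ⟨f, c, hf1, hf2⟩ := geometric_hahn_banach_open_open hconv.interior isOpen_interior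
    (hconv.interior.translate (s • u)) (isOpenMap_add_left (s • u) _ isOpen_interior) hdisj
  have hcl : C ⊆ closure (interior C) := by
    rw [hconv.closure_interior_eq_closure_of_nonempty_interior hne]
    exact subset_closure
  have hup : ∀ x ∈ C, f x ≤ c := fun x hx =>
    closure_minimal (fun y hy => (hf1 y hy).le) (isClosed_le f.continuous continuous_const)
      (hcl hx)
  have hlow : ∀ x ∈ C, c - s * f u ≤ f x := fun x hx =>
    closure_minimal (t := {y | c - s * f u ≤ f y}) (fun y hy => by
      have := hf2 _ ⟨y, hy, rfl⟩
      simp only [map_add, map_smul, smul_eq_mul] at this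
      simp only [Set.mem_ofPred_eq]
      linarith) (isClosed_le continuous_const f.continuous) (hcl hx)
  obtain ⟨z, hz⟩ := hne
  have hpos : 0 < s * f u := by
    have h1 := hf1 z hz
    have h2 := hf2 _ ⟨z, hz, rfl⟩
    simp only [map_add, map_smul, smul_eq_mul] at h2
    linarith
  -- After normalizing the normal vector, the strip has width `s * f u / ‖g‖ ≤ s`.
  set g := (InnerProductSpace.toDual ℝ (E d)).symm f with hg
  have hgf : ∀ x, inner ℝ g x = f x := fun x => InnerProductSpace.toDual_symm_apply
  have hg0 : 0 < ‖g‖ := by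
    rw [norm_pos_iff]
    intro h0
    rw [← hgf, h0, inner_zero_left, mul_zero] at hpos
    exact hpos.false
  have hm : ‖‖g‖⁻¹ • g‖ = 1 := by
    rw [norm_smul, norm_inv, norm_norm, inv_mul_cancel₀ hg0.ne']
  have hle : widthIn (‖g‖⁻¹ • g) C ≤ ‖g‖⁻¹ * c - ‖g‖⁻¹ * (c - s * f u) := by
    refine widthIn_le (mul_lt_mul_of_pos_left (by linarith) (inv_pos.2 hg0)) fun x hx => ?_
    simp only [strip, Set.mem_ofPred_eq, real_inner_smul_left, hgf]
    exact ⟨mul_le_mul_of_nonneg_left (hlow x hx) (inv_nonneg.2 hg0.le),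
      mul_le_mul_of_nonneg_left (hup x hx) (inv_nonneg.2 hg0.le)⟩
  have hfu : ‖g‖⁻¹ * f u ≤ 1 := by
    rw [inv_mul_le_iff₀ hg0, mul_one, ← hgf]
    exact (real_inner_le_norm g u).trans (mul_le_of_le_one_right hg0.le hu)
  have := minWidth_le_widthIn hm C
  nlinarith

/-- Needed so that the `sSup` in `lambda` is a true supremum and not the default value `0`. -/
theorem lambda_bddAbove [NeZero d] (n : ℕ) {C : Set (E d)} (hC : C ∈ convexBodies d) :
    BddAbove {r : ℝ | ∃ P : Set (E d), IsPolytope P ∧ P ⊆ C ∧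
      (P.extremePoints ℝ).encard ≤ (n : ℕ∞) ∧ r = minWidth P / minWidth C} := by
  refine ⟨1, ?_⟩
  rintro r ⟨P, -, hPC, -, rfl⟩
  exact div_le_one_of_le₀ (minWidth_mono hC.2.1 hPC) (minWidth_nonneg C)

theorem convexBodies_nonempty (d : ℕ) : (convexBodies d).Nonempty :=
  ⟨Metric.ball 0 1, convex_ball 0 1, Metric.isBounded_ball,
    by rw [Metric.isOpen_ball.interior_eq]; exact Metric.nonempty_ball.2 one_pos⟩

/-- If the directions of `k` vectors of the unit ball come close to every direction, then every
convex body contains a polytope with at most `2 * k` vertices and of large minimal width. -/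
theorem le_Lambda_of_directions [NeZero d] {k : ℕ} [NeZero k] {c : ℝ} (v : Fin k → E d)
    (hv : ∀ i, ‖v i‖ ≤ 1) (hcov : ∀ m : E d, ‖m‖ = 1 → ∃ i, c ≤ |inner ℝ m (v i)|) :
    c ≤ Lambda (2 * k) (convexBodies d) := by
  classical
  obtain ⟨C₀, hC₀⟩ := convexBodies_nonempty d
  refine le_csInf ⟨_, C₀, hC₀, rfl⟩ ?_
  rintro _ ⟨C, hC, rfl⟩
  have hw := minWidth_pos hC
  -- `C` need not be closed, so chords of length exactly `w(C)` may be missing; each `c' < c` is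
  -- reached with chords slightly shorter than `w(C)`.
  refine le_of_forall_lt_imp_le_of_dense fun c' hc' => ?_
  rcases le_or_gt c 0 with hc0 | hc0
  · refine (hc'.le.trans hc0).trans (Real.sSup_nonneg ?_)
    rintro r ⟨P, -, -, -, rfl⟩
    exact div_nonneg (minWidth_nonneg P) hw.le
  obtain ⟨s, hs1, hs2⟩ := exists_between
    (show max 0 (c' / c) * minWidth C < minWidth C from
      mul_lt_of_lt_one_left hw (max_lt one_pos ((div_lt_one hc0).2 hc')))
  have hs0 : 0 ≤ s := (mul_nonneg (le_max_left _ _) hw.le).trans hs1.le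
  choose x hx hxs using fun i => exists_chord hC (hv i) hs0 hs2
  set V : Finset (E d) := Finset.univ.image x ∪ Finset.univ.image fun i => x i + s • v i with hV
  have hxV : ∀ i, x i ∈ convexHull ℝ (V : Set (E d)) := fun i =>
    subset_convexHull ℝ _ (by simp [hV])
  have hyV : ∀ i, x i + s • v i ∈ convexHull ℝ (V : Set (E d)) := fun i =>
    subset_convexHull ℝ _ (by simp [hV])
  have hVC : convexHull ℝ (V : Set (E d)) ⊆ C := by
    refine convexHull_min ?_ hC.1
    intro y hy
    simp only [hV, Finset.coe_union, Finset.coe_image, Finset.coe_univ, Set.image_univ,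
      Set.mem_union, Set.mem_range] at hy
    rcases hy with ⟨i, rfl⟩ | ⟨i, rfl⟩
    exacts [hx i, hxs i]
  have hcard : V.card ≤ 2 * k := by
    refine (Finset.card_union_le _ _).trans ?_
    have h1 := Finset.card_image_le (s := (Finset.univ : Finset (Fin k))) (f := x)
    have h2 := Finset.card_image_le (s := (Finset.univ : Finset (Fin k)))
      (f := fun i => x i + s • v i)
    simp only [Finset.card_univ, Fintype.card_fin] at h1 h2
    omega
  have hwP : s * c ≤ minWidth (convexHull ℝ (V : Set (E d))) := by
    refine le_minWidth fun m hm => ?_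
    obtain ⟨i, hi⟩ := hcov m hm
    have h := abs_inner_sub_le_widthIn (hC.2.1.subset hVC) m (hxV i) (hyV i)
    rw [add_sub_cancel_left, real_inner_smul_right, abs_mul, abs_of_nonneg hs0] at h
    exact (mul_le_mul_of_nonneg_left hi hs0).trans h
  have hle : minWidth (convexHull ℝ (V : Set (E d))) / minWidth C ≤ lambda (2 * k) C := by
    refine le_csSup (lambda_bddAbove _ hC) ⟨_, ⟨V, ?_, rfl⟩, hVC, ?_, rfl⟩
    · exact ⟨x 0, by simp [hV]⟩
    · refine (Set.encard_le_encard extremePoints_convexHull_subset).trans ?_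
      rw [Set.encard_coe_eq_coe_finsetCard]
      exact_mod_cast hcard
  refine le_trans ?_ hle
  rw [le_div_iff₀ hw]
  refine le_trans ?_ hwP
  have h1 : c' / c * minWidth C ≤ s :=
    (mul_le_mul_of_nonneg_right (le_max_right _ _) hw.le).trans hs1.le
  calc c' * minWidth C = c' / c * minWidth C * c := by field_simp
    _ ≤ s * c := mul_le_mul_of_nonneg_right h1 hc0.le

/-! ### Polytopes cut out by integer slabs. -/

/-- The slab `|x * X + y * Y + z * Z| ≤ n` with integer coefficients; also the point with
homogeneous coordinates `(x : y : z : n)`. -/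
structure Slab where
  x : ℤ
  y : ℤ
  z : ℤ
  n : ℤ

namespace Slab

/-- The slab with the negated right-hand side. -/
def flip (a : Slab) : Slab := ⟨a.x, a.y, a.z, -a.n⟩

/-- The homogeneous coordinates of the intersection of the planes `x * X + y * Y + z * Z = n` of
three slabs. -/
def vertex (a b c : Slab) : Slab where
  x := a.n * (b.y * c.z - b.z * c.y) + b.n * (c.y * a.z - c.z * a.y) +
    c.n * (a.y * b.z - a.z * b.y)
  y := a.n * (b.z * c.x - b.x * c.z) + b.n * (c.z * a.x - c.x * a.z) +
    c.n * (a.z * b.x - a.x * b.z)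
  z := a.n * (b.x * c.y - b.y * c.x) + b.n * (c.x * a.y - c.y * a.x) +
    c.n * (a.x * b.y - a.y * b.x)
  n := a.x * (b.y * c.z - b.z * c.y) + a.y * (b.z * c.x - b.x * c.z) +
    a.z * (b.x * c.y - b.y * c.x)

/-- The point `p` is at infinity, or in the ball of radius `√(Q / P)`, or outside of a slab
of `L`. -/
def Harmless (L : List Slab) (P Q : ℤ) (p : Slab) : Prop :=
  p.n = 0 ∨ P * (p.x ^ 2 + p.y ^ 2 + p.z ^ 2) ≤ Q * p.n ^ 2 ∨
    ∃ e ∈ L, e.n ^ 2 * p.n ^ 2 < (e.x * p.x + e.y * p.y + e.z * p.z) ^ 2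

instance (L : List Slab) (P Q : ℤ) (p : Slab) : Decidable (Harmless L P Q p) := by
  unfold Harmless; infer_instance

/-- All vertices of the polytope cut out by the slabs of `L` lie in the ball of radius
`√(Q / P)`. -/
def VerticesSmall (L : List Slab) (P Q : ℤ) : Prop :=
  ∀ a ∈ L, ∀ b ∈ L, ∀ c ∈ L, Harmless L P Q (vertex a b c) ∧ Harmless L P Q (vertex a b c.flip) ∧
    Harmless L P Q (vertex a b.flip c) ∧ Harmless L P Q (vertex a b.flip c.flip)

instance (L : List Slab) (P Q : ℤ) : Decidable (VerticesSmall L P Q) := by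
  unfold VerticesSmall; infer_instance

/-- The linear form of a slab. -/
def eval (a : Slab) (p : Fin 3 → ℝ) : ℝ := a.x * p 0 + a.y * p 1 + a.z * p 2

theorem continuous_eval (a : Slab) : Continuous a.eval := by
  unfold eval; fun_prop

theorem eval_neg (a : Slab) (p : Fin 3 → ℝ) : a.eval (-p) = -a.eval p := by
  simp only [eval, Pi.neg_apply]; ring

theorem eval_flip (a : Slab) (p : Fin 3 → ℝ) : a.flip.eval p = a.eval p := rfl

theorem eval_add_smul (a : Slab) (p w : Fin 3 → ℝ) (ε : ℝ) :
    a.eval (p + ε • w) = a.eval p + ε * a.eval w := by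
  simp only [eval, Pi.add_apply, Pi.smul_apply, smul_eq_mul]; ring

/-- The squared Euclidean norm. -/
def normSq (p : Fin 3 → ℝ) : ℝ := p 0 ^ 2 + p 1 ^ 2 + p 2 ^ 2

theorem continuous_normSq : Continuous normSq := by
  unfold normSq; fun_prop

theorem normSq_neg (p : Fin 3 → ℝ) : normSq (-p) = normSq p := by
  simp only [normSq, Pi.neg_apply]; ring

/-- The polytope cut out by the slabs of `L`, scaled by `c`. -/
def body (L : List Slab) (c : ℝ) : Set (Fin 3 → ℝ) := {p | ∀ a ∈ L, |a.eval p| ≤ c * a.n}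

theorem neg_mem_body {L : List Slab} {c : ℝ} {p : Fin 3 → ℝ} (hp : p ∈ body L c) :
    -p ∈ body L c := fun a ha => by
  rw [eval_neg, abs_neg]; exact hp a ha

/-- Cramer's rule. -/
theorem vertex_spec {a b c : Slab} {r : ℝ} {p : Fin 3 → ℝ} (ha : a.eval p = r * a.n)
    (hb : b.eval p = r * b.n) (hc : c.eval p = r * c.n) :
    (vertex a b c).n * p 0 = r * (vertex a b c).x ∧
    (vertex a b c).n * p 1 = r * (vertex a b c).y ∧
    (vertex a b c).n * p 2 = r * (vertex a b c).z := by
  simp only [eval, vertex] at *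
  push_cast
  refine ⟨?_, ?_, ?_⟩
  · linear_combination (b.y * c.z - b.z * c.y : ℝ) * ha + (c.y * a.z - c.z * a.y : ℝ) * hb +
      (a.y * b.z - a.z * b.y : ℝ) * hc
  · linear_combination (b.z * c.x - b.x * c.z : ℝ) * ha + (c.z * a.x - c.x * a.z : ℝ) * hb +
      (a.z * b.x - a.x * b.z : ℝ) * hc
  · linear_combination (b.x * c.y - b.y * c.x : ℝ) * ha + (c.x * a.y - c.y * a.x : ℝ) * hb +
      (a.x * b.y - a.y * b.x : ℝ) * hc

/-- If two normals are independent, their cross product works, since its product with a third normal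
is the vanishing determinant. Otherwise all normals are parallel, and one explicit vector
perpendicular to a single normal suffices. -/
theorem exists_orthogonal {S : Set Slab}
    (h : ∀ a ∈ S, ∀ b ∈ S, ∀ c ∈ S, (vertex a b c).n = 0) :
    ∃ w : Fin 3 → ℝ, 0 < normSq w ∧ ∀ a ∈ S, a.eval w = 0 := by
  have pos : ∀ w : Fin 3 → ℝ, w ≠ 0 → 0 < normSq w := by
    intro w hw
    by_contra! hle
    apply hw
    unfold normSq at hle
    ext i
    fin_cases i <;> simp <;> nlinarith [sq_nonneg (w 0), sq_nonneg (w 1), sq_nonneg (w 2)]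
  by_cases h2 : ∃ a ∈ S, ∃ b ∈ S, (![(a.y * b.z - a.z * b.y : ℝ), a.z * b.x - a.x * b.z,
      a.x * b.y - a.y * b.x] : Fin 3 → ℝ) ≠ 0
  · obtain ⟨a, ha, b, hb, hab⟩ := h2
    refine ⟨_, pos _ hab, fun c hc => ?_⟩
    have h0 : ((vertex a b c).n : ℝ) = 0 := by exact_mod_cast h a ha b hb c hc
    simp only [vertex] at h0
    push_cast at h0
    simp only [eval, Matrix.cons_val]
    linear_combination h0
  push Not at h2
  have h3 : ∀ a ∈ S, ∀ b ∈ S, (a.y * b.z - a.z * b.y : ℝ) = 0 ∧ (a.z * b.x - a.x * b.z : ℝ) = 0 ∧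
      (a.x * b.y - a.y * b.x : ℝ) = 0 := fun a ha b hb =>
    ⟨congrFun (h2 a ha b hb) 0, congrFun (h2 a ha b hb) 1, congrFun (h2 a ha b hb) 2⟩
  by_cases h1 : ∃ a ∈ S, (![-(a.y : ℝ), a.x, 0] : Fin 3 → ℝ) ≠ 0
  · obtain ⟨a, ha, h0⟩ := h1
    refine ⟨_, pos _ h0, fun b hb => ?_⟩
    simp only [eval, Matrix.cons_val]
    linear_combination (h3 a ha b hb).2.2
  push Not at h1
  refine ⟨![1, 0, 0], by simp [normSq], fun a ha => ?_⟩
  have : (a.x : ℝ) = 0 := congrFun (h1 a ha) 1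
  simp [eval, this]

/-- Every point of largest norm lies on three linearly independent facet planes. -/
theorem exists_tight {L : List Slab} {c : ℝ} {p : Fin 3 → ℝ} (hp : p ∈ body L c)
    (hmax : ∀ q ∈ body L c, normSq q ≤ normSq p) :
    ∃ a₁ ∈ L, ∃ a₂ ∈ L, ∃ a₃ ∈ L, |a₁.eval p| = c * a₁.n ∧ |a₂.eval p| = c * a₂.n ∧
      |a₃.eval p| = c * a₃.n ∧ (vertex a₁ a₂ a₃).n ≠ 0 := by
  by_contra! hcon
  -- A vector `w` orthogonal to all active normals allows moving from `p` by `±ε • w` inside the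
  -- body. The two squared norms average to `normSq p + ε ^ 2 * normSq w`, contradicting maximality.
  obtain ⟨w, hw, horth⟩ := exists_orthogonal (S := {a | a ∈ L ∧ |a.eval p| = c * a.n})
    fun a ha b hb e he => hcon a ha.1 b hb.1 e he.1 ha.2 hb.2 he.2
  have key : ∀ᶠ ε : ℝ in nhds 0, p + ε • w ∈ body L c := by
    refine (Filter.eventually_all_finite L.finite_toSet).2 fun a ha => ?_
    rcases (hp a ha).eq_or_lt with heq | hlt
    · refine Filter.Eventually.of_forall fun ε => ?_
      rw [eval_add_smul, horth a ⟨ha, heq⟩, mul_zero, add_zero]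
      exact heq.le
    · have hcont : Continuous fun ε : ℝ => |a.eval (p + ε • w)| :=
        (a.continuous_eval.comp (by fun_prop)).abs
      exact ((hcont.tendsto 0).eventually_lt_const (by simpa using hlt)).mono fun ε h => h.le
  have key' : ∀ᶠ ε : ℝ in nhds 0, p + (-ε) • w ∈ body L c :=
    (continuous_neg.tendsto' (0 : ℝ) 0 neg_zero).eventually key
  obtain ⟨ε, ⟨h1, h2⟩, hε⟩ := (((key.and key').filter_mono nhdsWithin_le_nhds).and
    (self_mem_nhdsWithin (s := Set.Ioi (0 : ℝ)))).exists
  have e1 := hmax _ h1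
  have e2 := hmax _ h2
  have : 0 < ε ^ 2 * normSq w := mul_pos (pow_pos hε 2) hw
  simp only [normSq, Pi.add_apply, Pi.smul_apply, smul_eq_mul] at *
  nlinarith

/-- By Cramer's rule, three independent slabs bound every coordinate; their determinant is a nonzero
integer, so its absolute value is at least 1. -/
theorem isCompact_body {L : List Slab} {c : ℝ}
    (hL : ∃ a₁ ∈ L, ∃ a₂ ∈ L, ∃ a₃ ∈ L, (vertex a₁ a₂ a₃).n ≠ 0) : IsCompact (body L c) := by
  obtain ⟨a, ha, b, hb, e, he, hdet⟩ := hL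
  have hclosed : IsClosed (body L c) := by
    simp only [body, Set.ofPred_forall]
    exact isClosed_iInter fun a => isClosed_iInter fun _ =>
      isClosed_le a.continuous_eval.abs continuous_const
  have bound : ∀ u v w d t : ℝ, ∀ p ∈ body L c, 1 ≤ |d| →
      d * t = u * a.eval p + v * b.eval p + w * e.eval p →
      |t| ≤ |u| * (c * a.n) + |v| * (c * b.n) + |w| * (c * e.n) := by
    intro u v w d t p hp hd h
    calc |t| ≤ |d| * |t| := le_mul_of_one_le_left (abs_nonneg t) hd
      _ = |u * a.eval p + v * b.eval p + w * e.eval p| := by rw [← abs_mul, h]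
      _ ≤ |u * a.eval p| + |v * b.eval p| + |w * e.eval p| := abs_add_three _ _ _
      _ ≤ _ := by
        rw [abs_mul, abs_mul, abs_mul]
        gcongr
        exacts [hp a ha, hp b hb, hp e he]
  have hd : (1 : ℝ) ≤ |((vertex a b e).n : ℝ)| := by exact_mod_cast Int.one_le_abs hdet
  have hcoord : ∀ i : Fin 3, ∃ B : ℝ, ∀ p ∈ body L c, |p i| ≤ B := by
    intro i
    fin_cases i
    · refine ⟨_, fun p hp => bound (b.y * e.z - b.z * e.y) (e.y * a.z - e.z * a.y)
        (a.y * b.z - a.z * b.y) _ _ p hp hd ?_⟩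
      simp only [eval, vertex]; push_cast; ring_nf
    · refine ⟨_, fun p hp => bound (b.z * e.x - b.x * e.z) (e.z * a.x - e.x * a.z)
        (a.z * b.x - a.x * b.z) _ _ p hp hd ?_⟩
      simp only [eval, vertex]; push_cast; ring_nf
    · refine ⟨_, fun p hp => bound (b.x * e.y - b.y * e.x) (e.x * a.y - e.y * a.x)
        (a.x * b.y - a.y * b.x) _ _ p hp hd ?_⟩
      simp only [eval, vertex]; push_cast; ring_nf
  choose B hB using hcoord
  refine (isCompact_Icc (a := fun i => -B i) (b := B)).of_isClosed_subset hclosed fun p hp => ?_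
  exact ⟨fun i => (abs_le.1 (hB i p hp)).1, fun i => (abs_le.1 (hB i p hp)).2⟩

/-- A point of the polytope that is the vertex of three scaled slabs lies in the unit ball if the
vertex is harmless. -/
theorem normSq_le_one {L : List Slab} {c : ℝ} {P Q : ℤ} (hc : 0 < c) (hQ : 0 < Q)
    (hcPQ : c ^ 2 * Q = P) {p : Fin 3 → ℝ} (hp : p ∈ body L c) {a₁ a₂ a₃ : Slab}
    (h₁ : a₁.eval p = c * a₁.n) (h₂ : a₂.eval p = c * a₂.n) (h₃ : a₃.eval p = c * a₃.n)
    (hdet : (vertex a₁ a₂ a₃).n ≠ 0) (hv : Harmless L P Q (vertex a₁ a₂ a₃)) :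
    normSq p ≤ 1 := by
  obtain ⟨hx, hy, hz⟩ := vertex_spec h₁ h₂ h₃
  set v := vertex a₁ a₂ a₃
  have hn : 0 < (v.n : ℝ) ^ 2 := by
    have : (v.n : ℝ) ≠ 0 := by exact_mod_cast hdet
    positivity
  have hQ' : (0 : ℝ) < Q := by exact_mod_cast hQ
  rcases hv with h | h | ⟨e, he, h⟩
  · exact absurd h hdet
  · have h' : (P * (v.x ^ 2 + v.y ^ 2 + v.z ^ 2) : ℝ) ≤ Q * v.n ^ 2 := by exact_mod_cast h
    have h1 : (v.n : ℝ) ^ 2 * normSq p = c ^ 2 * (v.x ^ 2 + v.y ^ 2 + v.z ^ 2) := by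
      calc (v.n : ℝ) ^ 2 * normSq p = (v.n * p 0) ^ 2 + (v.n * p 1) ^ 2 + (v.n * p 2) ^ 2 := by
            unfold normSq; ring
        _ = _ := by rw [hx, hy, hz]; ring
    rw [← hcPQ] at h'
    have h2 : (v.n : ℝ) ^ 2 * normSq p ≤ v.n ^ 2 := by
      rw [h1]
      refine le_of_mul_le_mul_left ?_ hQ'
      linarith
    nlinarith
  · exfalso
    have h' : (e.n ^ 2 * v.n ^ 2 : ℝ) < (e.x * v.x + e.y * v.y + e.z * v.z) ^ 2 := by
      exact_mod_cast h
    have h1 : v.n * e.eval p = c * (e.x * v.x + e.y * v.y + e.z * v.z) := by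
      unfold eval
      linear_combination (e.x : ℝ) * hx + (e.y : ℝ) * hy + (e.z : ℝ) * hz
    have h2 : e.eval p ^ 2 ≤ (c * e.n) ^ 2 := by
      rw [← sq_abs]
      exact pow_le_pow_left₀ (abs_nonneg _) (hp e he) 2
    have h3 : (v.n * e.eval p) ^ 2 ≤ c ^ 2 * (e.n ^ 2 * v.n ^ 2) := by
      calc (v.n * e.eval p) ^ 2 = v.n ^ 2 * e.eval p ^ 2 := by ring
        _ ≤ v.n ^ 2 * (c * e.n) ^ 2 := mul_le_mul_of_nonneg_left h2 hn.le
        _ = _ := by ring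
    rw [h1, mul_pow] at h3
    exact absurd (le_of_mul_le_mul_left h3 (by positivity)) (not_le.2 h')

theorem exists_eval_eq {a : Slab} {c : ℝ} {p : Fin 3 → ℝ} (h : |a.eval p| = c * a.n) :
    a.eval p = c * a.n ∨ a.flip.eval p = c * a.flip.n := by
  rcases abs_choice (a.eval p) with h' | h'
  · exact Or.inl (h' ▸ h)
  · refine Or.inr ?_
    rw [eval_flip, flip]
    push_cast
    linarith

theorem normSq_le_one_of_max {L : List Slab} {c : ℝ} {P Q : ℤ} (hc : 0 < c) (hQ : 0 < Q)
    (hcPQ : c ^ 2 * Q = P) (hV : VerticesSmall L P Q) {p : Fin 3 → ℝ} (hp : p ∈ body L c)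
    (hmax : ∀ q ∈ body L c, normSq q ≤ normSq p) : normSq p ≤ 1 := by
  obtain ⟨a, ha, b, hb, e, he, ta, tb, te, hdet⟩ := exists_tight hp hmax
  have main : ∀ q ∈ body L c, a.eval q = c * a.n → |b.eval q| = c * b.n →
      |e.eval q| = c * e.n → normSq q ≤ 1 := by
    intro q hq h₁ h₂ h₃
    obtain ⟨v₁, v₂, v₃, v₄⟩ := hV a ha b hb e he
    rcases exists_eval_eq h₂ with h₂ | h₂ <;> rcases exists_eval_eq h₃ with h₃ | h₃
    · exact normSq_le_one hc hQ hcPQ hq h₁ h₂ h₃ hdet v₁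
    · exact normSq_le_one hc hQ hcPQ hq h₁ h₂ h₃ hdet v₂
    · exact normSq_le_one hc hQ hcPQ hq h₁ h₂ h₃ hdet v₃
    · exact normSq_le_one hc hQ hcPQ hq h₁ h₂ h₃ hdet v₄
  -- The symmetry `p ↦ -p` makes the first sign positive, which is why `VerticesSmall` lists only
  -- four of the eight sign patterns.
  rcases abs_choice (a.eval p) with h | h
  · exact main p hp (h ▸ ta) tb te
  · rw [← normSq_neg]
    refine main (-p) (neg_mem_body hp) ?_ ?_ ?_
    · rw [eval_neg, ← h, ta]
    · rw [eval_neg, abs_neg, tb]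
    · rw [eval_neg, abs_neg, te]

/-- If all vertices are small, then every unit vector leaves one of the scaled slabs or lies on
its boundary. -/
theorem exists_le_abs_eval {L : List Slab} {c : ℝ} {P Q : ℤ} (hc : 0 < c) (hQ : 0 < Q)
    (hcPQ : c ^ 2 * Q = P) (hV : VerticesSmall L P Q)
    (hL : ∃ a₁ ∈ L, ∃ a₂ ∈ L, ∃ a₃ ∈ L, (vertex a₁ a₂ a₃).n ≠ 0) {p : Fin 3 → ℝ}
    (hp : normSq p = 1) : ∃ a ∈ L, c * a.n ≤ |a.eval p| := by
  by_contra! hcon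
  have hpb : p ∈ body L c := fun a ha => (hcon a ha).le
  obtain ⟨q, hq, hmax⟩ := (isCompact_body hL).exists_isMaxOn ⟨p, hpb⟩
    continuous_normSq.continuousOn
  have hq1 := normSq_le_one_of_max hc hQ hcPQ hV hq hmax
  -- The maximal norm is at most `1`, so the unit vector `p` is itself a maximizer and touches a
  -- facet.
  obtain ⟨a, ha, -, -, -, -, h, -⟩ := exists_tight hpb fun r hr =>
    (hmax hr).trans (hq1.trans hp.ge)
  exact (hcon a ha).ne h

/-- The slabs have normal vectors of length at most `n`, three of which are independent. -/
def Proper (L : List Slab) : Prop :=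
  (∀ a ∈ L, 0 < a.n ∧ a.x ^ 2 + a.y ^ 2 + a.z ^ 2 ≤ a.n ^ 2) ∧
    ∃ a₁ ∈ L, ∃ a₂ ∈ L, ∃ a₃ ∈ L, (vertex a₁ a₂ a₃).n ≠ 0

instance (L : List Slab) : Decidable (Proper L) := by
  unfold Proper; infer_instance

end Slab

/-! ### Bounds certified by integer arithmetic. -/

/-- The directions are the normals divided by `n`; an integer `n` at least the length keeps them
rational and in the unit ball. Only `c ^ 2 = P / Q` has to be rational, and unscaled vertices are
compared with the radius `1 / c = √(Q / P)`. -/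
theorem le_Lambda_of_slabs (L : List Slab) {k : ℕ} [NeZero k] (hk : L.length = k) {c : ℝ} (P Q : ℤ)
    (hc : 0 < c) (hQ : 0 < Q) (hcPQ : c ^ 2 * Q = P) (hL : Slab.Proper L)
    (hV : Slab.VerticesSmall L P Q) :
    c ≤ Lambda (2 * k) (convexBodies 3) := by
  subst hk
  set v : Fin L.length → EuclideanSpace ℝ (Fin 3) := fun i =>
    !₂[(L.get i).x / (L.get i).n, (L.get i).y / (L.get i).n, (L.get i).z / (L.get i).n] with hv
  refine le_Lambda_of_directions v (fun i => ?_) fun m hm => ?_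
  · obtain ⟨hn, h⟩ := hL.1 _ (L.get_mem i)
    have hn' : (0 : ℝ) < (L.get i).n := by exact_mod_cast hn
    have h' : ((L.get i).x ^ 2 + (L.get i).y ^ 2 + (L.get i).z ^ 2 : ℝ) ≤ (L.get i).n ^ 2 := by
      exact_mod_cast h
    rw [← sq_le_one_iff₀ (norm_nonneg _), EuclideanSpace.norm_sq_eq, Fin.sum_univ_three]
    simp only [hv, Real.norm_eq_abs, sq_abs, PiLp.toLp_apply, Matrix.cons_val, div_pow]
    rw [← add_div, ← add_div]
    exact div_le_one_of_le₀ h' (by positivity)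
  · have hm' : Slab.normSq m.ofLp = 1 := by
      have := EuclideanSpace.norm_sq_eq m
      rw [hm, Fin.sum_univ_three] at this
      simp only [Real.norm_eq_abs, sq_abs] at this
      rw [Slab.normSq, ← this, one_pow]
    obtain ⟨a, ha, h⟩ := Slab.exists_le_abs_eval hc hQ hcPQ hV hL.2 hm'
    obtain ⟨i, rfl⟩ := List.get_of_mem ha
    have hn' : (0 : ℝ) < (L.get i).n := by exact_mod_cast (hL.1 _ (L.get_mem i)).1
    refine ⟨i, ?_⟩
    have : inner ℝ m (v i) = (L.get i).eval m.ofLp / (L.get i).n := by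
      simp only [PiLp.inner_apply, Fin.sum_univ_three, hv, Slab.eval, Matrix.cons_val,
        RCLike.inner_apply, conj_trivial]
      ring
    rw [this, abs_div, abs_of_pos hn', le_div_iff₀ hn']
    exact h

theorem inv_sqrt_three_le_Lambda_six : 1 / Real.sqrt 3 ≤ Lambda 6 (convexBodies 3) := by
  refine le_Lambda_of_slabs [⟨1, 0, 0, 1⟩, ⟨0, 1, 0, 1⟩, ⟨0, 0, 1, 1⟩] (k := 3) rfl 1 3
    (by positivity) (by norm_num) ?_ (by decide +kernel) (by decide +kernel)
  rw [div_pow, Real.sq_sqrt] <;> norm_num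

theorem le_Lambda_eight : (0.654 : ℝ) ≤ Lambda 8 (convexBodies 3) :=
  le_Lambda_of_slabs [⟨-187, -3, 65, 198⟩, ⟨-132, 47, -108, 177⟩, ⟨-16, -167, -53, 176⟩,
    ⟨36, 51, -172, 183⟩] (k := 4) rfl 427716 1000000 (by norm_num) (by norm_num) (by norm_num)
    (by decide +kernel) (by decide +kernel)

theorem le_Lambda_ten : (0.695 : ℝ) ≤ Lambda 10 (convexBodies 3) :=
  le_Lambda_of_slabs [⟨-5, 11, -74, 75⟩, ⟨105, -141, 93, 199⟩, ⟨-96, 119, 72, 169⟩,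
    ⟨133, 132, 50, 194⟩, ⟨-128, -77, 28, 152⟩] (k := 5) rfl 483025 1000000 (by norm_num)
    (by norm_num) (by norm_num) (by decide +kernel) (by decide +kernel)

/-- The directions are the three axes and the four diagonals of a cube, with `26 / 15` as an upper
approximation of `√3`. -/
theorem le_Lambda_fourteen : (0.806 : ℝ) ≤ Lambda 14 (convexBodies 3) :=
  le_Lambda_of_slabs [⟨1, 0, 0, 1⟩, ⟨0, 1, 0, 1⟩, ⟨0, 0, 1, 1⟩, ⟨15, 15, 15, 26⟩,
    ⟨15, 15, -15, 26⟩, ⟨15, -15, 15, 26⟩, ⟨-15, 15, 15, 26⟩] (k := 7) rfl 649636 1000000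
    (by norm_num) (by norm_num) (by norm_num) (by decide +kernel) (by decide +kernel)

theorem le_Lambda_sixteen : (0.833 : ℝ) ≤ Lambda 16 (convexBodies 3) :=
  le_Lambda_of_slabs [⟨351, -59, -180, 399⟩, ⟨189, -228, 113, 317⟩, ⟨-63, 31, 200, 212⟩,
    ⟨96, 177, -113, 231⟩, ⟨134, -87, 337, 373⟩, ⟨-168, -263, -195, 368⟩, ⟨159, 38, 34, 167⟩,
    ⟨-82, 318, 99, 343⟩] (k := 8) rfl 693889 1000000 (by norm_num) (by norm_num) (by norm_num)
    (by decide +kernel) (by decide +kernel)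

/-! ### The icosahedral bound for 12 vertices. -/

/-- A point of the first octant in the slabs spanned by an icosahedron lies in the ball around
the opposite dodecahedron. -/
theorem sq_add_sq_add_sq_le_of_nonneg {φ : ℝ} (hφ0 : 0 < φ) (hφ : φ ^ 2 = φ + 1)
    {X Y Z t : ℝ} (hX : 0 ≤ X) (hY : 0 ≤ Y) (hZ : 0 ≤ Z)
    (h₁ : Y + φ * Z ≤ t) (h₂ : Z + φ * X ≤ t) (h₃ : X + φ * Y ≤ t) :
    φ ^ 4 * (X ^ 2 + Y ^ 2 + Z ^ 2) ≤ 3 * t ^ 2 := by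
  have hφ1 : 1 < φ := by nlinarith
  have hcube : φ ^ 3 = 2 * φ + 1 := by linear_combination (φ + 1) * hφ
  have h4 : φ ^ 4 = 3 * φ + 2 := by linear_combination (φ ^ 2 + φ + 2) * hφ
  have h5 : φ ^ 5 = 5 * φ + 3 := by linear_combination (φ ^ 3 + φ ^ 2 + 2 * φ + 3) * hφ
  have ht : 0 ≤ t := by nlinarith
  -- the norm is bounded by a linear form, then use the Cauchy-Schwarz inequality
  have cs : ∀ a b e : ℝ, φ ^ 4 * (a ^ 2 + b ^ 2 + e ^ 2) = 3 →
      X ^ 2 + Y ^ 2 + Z ^ 2 ≤ t * (a * X + b * Y + e * Z) →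
      φ ^ 4 * (X ^ 2 + Y ^ 2 + Z ^ 2) ≤ 3 * t ^ 2 := by
    intro a b e h h'
    set N := X ^ 2 + Y ^ 2 + Z ^ 2 with hN
    have hN0 : 0 ≤ N := by positivity
    rcases hN0.eq_or_lt with h0 | h0
    · rw [← h0, mul_zero]; positivity
    have h1 : (a * X + b * Y + e * Z) ^ 2 ≤ (a ^ 2 + b ^ 2 + e ^ 2) * N := by
      nlinarith [sq_nonneg (a * Y - b * X), sq_nonneg (a * Z - e * X), sq_nonneg (b * Z - e * Y)]
    have h2 : N ^ 2 ≤ t ^ 2 * ((a ^ 2 + b ^ 2 + e ^ 2) * N) := by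
      calc N ^ 2 ≤ (t * (a * X + b * Y + e * Z)) ^ 2 := pow_le_pow_left₀ hN0 h' 2
        _ = t ^ 2 * (a * X + b * Y + e * Z) ^ 2 := mul_pow _ _ _
        _ ≤ _ := mul_le_mul_of_nonneg_left h1 (sq_nonneg t)
    refine le_of_mul_le_mul_left ?_ h0
    calc N * (φ ^ 4 * N) = φ ^ 4 * N ^ 2 := by ring
      _ ≤ φ ^ 4 * (t ^ 2 * ((a ^ 2 + b ^ 2 + e ^ 2) * N)) :=
        mul_le_mul_of_nonneg_left h2 (by positivity)
      _ = φ ^ 4 * (a ^ 2 + b ^ 2 + e ^ 2) * t ^ 2 * N := by ring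
      _ = N * (3 * t ^ 2) := by rw [h]; ring
  have far : ∀ X Y Z : ℝ, 0 ≤ Y → 0 ≤ Z → Z + φ * X ≤ t → X + φ * Y ≤ t →
      0 ≤ φ * X - Y - φ ^ 2 * Z → X ^ 2 + Y ^ 2 + Z ^ 2 ≤ t * ((φ - 1) * X + (2 * φ - 3) * Y) := by
    intro X Y Z hY hZ h₂ h₃ h
    -- With `β`, `γ` the quantities bounded in `hβ`, `hγ`, the point is `(β + Z) • (φ, 0, 1) + β •
    -- (φ, 0, -1) + γ • (1, φ, 0)`, in terms of the three facet normals at the vertex `t * (φ - 1,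
    -- 2φ - 3, 0)`.
    have hβ : 0 ≤ (φ - 1) ^ 2 / 2 * (φ * X - Y - φ ^ 2 * Z) := mul_nonneg (by positivity) h
    have hγ : 0 ≤ (φ - 1) * Y := mul_nonneg (by linarith) hY
    have e1 := mul_nonneg (add_nonneg hβ hZ) (sub_nonneg.2 h₂)
    have e2 := mul_nonneg hβ (show 0 ≤ t - (φ * X - Z) by linarith)
    have e3 := mul_nonneg hγ (sub_nonneg.2 h₃)
    ring_nf at e1 e2 e3 ⊢
    simp only [hφ, hcube, h4, h5] at e1 e2 e3
    linarith
  have hq : φ ^ 4 * ((φ - 1) ^ 2 + (2 * φ - 3) ^ 2) = 3 := by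
    rw [h4]
    linear_combination (15 * φ - 17) * hφ
  -- The sign tells whether `(φ - 1, 2φ - 3, 0)` or `(2 - φ) * (1, 1, 1)` has the larger inner
  -- product with the point; the next two cases are its cyclic shifts, and the diagonal vertex
  -- remains.
  by_cases hx : 0 ≤ φ * X - Y - φ ^ 2 * Z
  · refine cs (φ - 1) (2 * φ - 3) 0 (by linear_combination hq) ?_
    have := far X Y Z hY hZ h₂ h₃ hx
    linarith
  by_cases hy : 0 ≤ φ * Y - Z - φ ^ 2 * X
  · refine cs 0 (φ - 1) (2 * φ - 3) (by linear_combination hq) ?_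
    have := far Y Z X hZ hX h₃ h₁ hy
    linarith
  by_cases hz : 0 ≤ φ * Z - X - φ ^ 2 * Y
  · refine cs (2 * φ - 3) 0 (φ - 1) (by linear_combination hq) ?_
    have := far Z X Y hX hY h₁ h₂ hz
    linarith
  push Not at hx hy hz
  refine cs (2 - φ) (2 - φ) (2 - φ) ?_ ?_
  · rw [h4]
    linear_combination (9 * φ - 21) * hφ
  · have e1 := mul_nonneg (neg_nonneg.2 hx.le) (sub_nonneg.2 h₁)
    have e2 := mul_nonneg (neg_nonneg.2 hy.le) (sub_nonneg.2 h₂)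
    have e3 := mul_nonneg (neg_nonneg.2 hz.le) (sub_nonneg.2 h₃)
    have e4 : φ ^ 2 * (X ^ 2 + Y ^ 2 + Z ^ 2) ≤ t * (X + Y + Z) := by
      ring_nf at e1 e2 e3 ⊢
      simp only [hφ, hcube] at e1 e2 e3 ⊢
      linarith
    have e5 : φ ^ 2 * (2 - φ) = 1 := by linear_combination (1 - φ) * hφ
    have e6 := mul_le_mul_of_nonneg_left e4 (show 0 ≤ 2 - φ by nlinarith)
    linear_combination e6 - (X ^ 2 + Y ^ 2 + Z ^ 2) * e5

theorem icosahedron_le_Lambda_twelve {φ : ℝ} (hφ0 : 0 < φ) (hφ : φ ^ 2 = φ + 1) {c : ℝ}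
    (hc2 : 3 * c ^ 2 * (1 + φ ^ 2) = φ ^ 4) :
    c ≤ Lambda 12 (convexBodies 3) := by
  set n : ℝ := √(1 + φ ^ 2) with hn
  have hn2 : n ^ 2 = 1 + φ ^ 2 := Real.sq_sqrt (by positivity)
  have hn0 : 0 < n := Real.sqrt_pos.2 (by positivity)
  refine le_Lambda_of_directions (k := 6) (![!₂[0, 1 / n, φ / n], !₂[0, 1 / n, -φ / n],
    !₂[φ / n, 0, 1 / n], !₂[-φ / n, 0, 1 / n], !₂[1 / n, φ / n, 0], !₂[1 / n, -φ / n, 0]])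
    (fun i => ?_) fun m hm => ?_
  · rw [← sq_le_one_iff₀ (norm_nonneg _), EuclideanSpace.norm_sq_eq, Fin.sum_univ_three]
    fin_cases i <;> simp [div_pow, abs_of_pos hn0, hn2] <;> field_simp <;>
      simp [add_comm]
  · have hm' : m 0 ^ 2 + m 1 ^ 2 + m 2 ^ 2 = 1 := by
      have := EuclideanSpace.norm_sq_eq m
      rw [hm, Fin.sum_univ_three] at this
      simp only [Real.norm_eq_abs, sq_abs] at this
      rw [← this, one_pow]
    by_contra! hcon
    -- in each pair of directions, the signs of the coordinates can be made to agree
    have abs_comb : ∀ a b : ℝ, |a + φ * b| < c * n → |a - φ * b| < c * n →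
        |a| + φ * |b| < c * n := by
      intro a b h₁ h₂
      rw [abs_lt] at h₁ h₂
      rcases abs_cases a with ⟨h, -⟩ | ⟨h, -⟩ <;> rcases abs_cases b with ⟨h', -⟩ | ⟨h', -⟩ <;>
        rw [h, h'] <;> linarith [h₁.1, h₁.2, h₂.1, h₂.2]
    have hinner : ∀ a b e : ℝ, inner ℝ m !₂[a, b, e] = a * m 0 + b * m 1 + e * m 2 := by
      intro a b e
      simp [PiLp.inner_apply, Fin.sum_univ_three]
    have scale : ∀ a : ℝ, |a / n| < c → |a| < c * n := fun a h => by
      rwa [abs_div, abs_of_pos hn0, div_lt_iff₀ hn0] at h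
    have g₁ : |m 1| + φ * |m 2| < c * n := by
      refine abs_comb _ _ (scale _ ?_) (scale _ ?_)
      · have h := hcon 0
        simp only [Matrix.cons_val, hinner] at h
        exact lt_of_eq_of_lt (congrArg _ (by ring)) h
      · have h := hcon 1
        simp only [Matrix.cons_val, hinner] at h
        exact lt_of_eq_of_lt (congrArg _ (by ring)) h
    have g₂ : |m 2| + φ * |m 0| < c * n := by
      refine abs_comb _ _ (scale _ ?_) (scale _ ?_)
      · have h := hcon 2
        simp only [Matrix.cons_val, hinner] at h
        exact lt_of_eq_of_lt (congrArg _ (by ring)) h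
      · have h := hcon 3
        simp only [Matrix.cons_val, hinner] at h
        exact lt_of_eq_of_lt (congrArg _ (by ring)) h
    have g₃ : |m 0| + φ * |m 1| < c * n := by
      refine abs_comb _ _ (scale _ ?_) (scale _ ?_)
      · have h := hcon 4
        simp only [Matrix.cons_val, hinner] at h
        exact lt_of_eq_of_lt (congrArg _ (by ring)) h
      · have h := hcon 5
        simp only [Matrix.cons_val, hinner] at h
        exact lt_of_eq_of_lt (congrArg _ (by ring)) h
    -- The strict inequalities leave room for `t < c * n`; then `φ ^ 4 ≤ 3 * t ^ 2` contradicts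
    -- `hc2`.
    obtain ⟨t, ht, htc⟩ := exists_between (max_lt g₁ (max_lt g₂ g₃))
    have hle := sq_add_sq_add_sq_le_of_nonneg hφ0 hφ (abs_nonneg (m 0)) (abs_nonneg (m 1))
      (abs_nonneg (m 2)) ((le_max_left _ _).trans ht.le)
      ((le_max_left _ _).trans ((le_max_right _ _).trans ht.le))
      ((le_max_right _ _).trans ((le_max_right _ _).trans ht.le))
    have ht0 : 0 ≤ t := (by positivity : 0 ≤ |m 1| + φ * |m 2|).trans
      ((le_max_left _ _).trans ht.le)
    simp only [sq_abs, hm', mul_one] at hle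
    have h1 : t ^ 2 < (c * n) ^ 2 := pow_lt_pow_left₀ htc ht0 two_ne_zero
    rw [mul_pow, hn2] at h1
    linarith

theorem cot_pi_div_five_sq : Real.cot (Real.pi / 5) ^ 2 = 1 + 2 * √5 / 5 := by
  have h5 : √5 ^ 2 = (5 : ℝ) := Real.sq_sqrt (by norm_num)
  have hs : Real.sin (Real.pi / 5) ^ 2 = (5 - √5) / 8 := by
    rw [Real.sin_sq, Real.cos_pi_div_five]
    linear_combination (-1 / 16) * h5
  have hpos : (5 - √5) ≠ 0 := by nlinarith
  rw [Real.cot_eq_cos_div_sin, div_pow, hs, Real.cos_pi_div_five]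
  field_simp
  nlinarith

end InscribedPolytope

theorem corollary2 :
    1 / Real.sqrt 3 ≤ InscribedPolytope.Lambda 6 (InscribedPolytope.convexBodies 3) ∧
    (0.654 : ℝ) ≤ InscribedPolytope.Lambda 8 (InscribedPolytope.convexBodies 3) ∧
    (0.695 : ℝ) ≤ InscribedPolytope.Lambda 10 (InscribedPolytope.convexBodies 3) ∧
    1 / Real.sqrt 3 * Real.cot (Real.pi / 5) ≤
      InscribedPolytope.Lambda 12 (InscribedPolytope.convexBodies 3) ∧
    (0.806 : ℝ) ≤ InscribedPolytope.Lambda 14 (InscribedPolytope.convexBodies 3) ∧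
    (0.833 : ℝ) ≤ InscribedPolytope.Lambda 16 (InscribedPolytope.convexBodies 3) ∧
    ((0.577 : ℝ) ≤ 1 / Real.sqrt 3 ∧ 1 / Real.sqrt 3 < 0.578) ∧
    ((0.794 : ℝ) ≤ 1 / Real.sqrt 3 * Real.cot (Real.pi / 5) ∧
      1 / Real.sqrt 3 * Real.cot (Real.pi / 5) < 0.795) := by
  have h3 : (√3 : ℝ) ^ 2 = 3 := Real.sq_sqrt (by norm_num)
  have h5 : (√5 : ℝ) ^ 2 = 5 := Real.sq_sqrt (by norm_num)
  have hcot : 0 < Real.cot (Real.pi / 5) := by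
    have hpi := Real.pi_pos
    rw [Real.cot_eq_cos_div_sin]
    exact div_pos (Real.cos_pos_of_mem_Ioo ⟨by linarith, by linarith⟩)
      (Real.sin_pos_of_pos_of_lt_pi (by linarith) (by linarith))
  have hc : 0 < 1 / Real.sqrt 3 * Real.cot (Real.pi / 5) := by positivity
  have hsq : (1 / Real.sqrt 3 * Real.cot (Real.pi / 5)) ^ 2 = (5 + 2 * √5) / 15 := by
    rw [mul_pow, div_pow, h3, InscribedPolytope.cot_pi_div_five_sq]
    ring
  have hlow : (2.236 : ℝ) < √5 := Real.lt_sqrt_of_sq_lt (by norm_num)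
  have hup : √5 < (2.237 : ℝ) := (Real.sqrt_lt' (by norm_num)).2 (by norm_num)
  refine ⟨InscribedPolytope.inv_sqrt_three_le_Lambda_six, InscribedPolytope.le_Lambda_eight,
    InscribedPolytope.le_Lambda_ten,
    InscribedPolytope.icosahedron_le_Lambda_twelve Real.goldenRatio_pos Real.goldenRatio_sq ?_,
    InscribedPolytope.le_Lambda_fourteen, InscribedPolytope.le_Lambda_sixteen,
    ⟨?_, ?_⟩, ?_, ?_⟩
  · rw [hsq, Real.goldenRatio]
    linear_combination (-(√5 ^ 2) / 16 - 3 * √5 / 20 - 19 / 80) * h5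
  · refine (pow_le_pow_iff_left₀ (by norm_num) (by positivity) two_ne_zero).1 ?_
    rw [div_pow, h3]
    norm_num
  · refine lt_of_pow_lt_pow_left₀ 2 (by norm_num) ?_
    rw [div_pow, h3]
    norm_num
  · refine (pow_le_pow_iff_left₀ (by norm_num) hc.le two_ne_zero).1 ?_
    rw [hsq]
    linarith
  · refine lt_of_pow_lt_pow_left₀ 2 (by norm_num) ?_
    rw [hsq]
    linarith
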